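/- Let $\mathbb K$ be an algebraically closed field, let $M\cong\mathbb Z^d$ be a lattice, and let $R=\bigoplus_{w\in M}R_w$ be a finitely generated integral $M$-graded $\mathbb K$-algebra. The grading defines an action of the torus $T=\operatorname{Spec}\mathbb K[M]$ on the affine variety $X=\operatorname{Spec}R$; points of $X$ are closed points. Put $M_{\mathbb Q}=\mathbb Q\otimes_{\mathbb Z}M$. The weight cone $\Omega_T(X)\subset M_{\mathbb Q}$ is the convex cone generated by all $w\in M$ with $R_w\neq0$. For $x\in X$ the orbit cone $\omega_T(x)\subset M_{\mathbb Q}$ is the convex cone generated by all $w\in M$ for which there is an $f\in R_w$ with $f(x)\ne0$. For $w\in\Omega_T(X)\cap M$ the GIT-cone is $\sigma_T(w)=\bigcap_{x\in X,\;w\in\omega_T(x)}\omega_T(x)$, and $\Sigma_T(X)=\{\sigma_T(w);\;w\in\Omega_T(X)\cap M\}$. A quasifan in $M_{\mathbb Q}$ is a finite collection of (not necessarily pointed) convex polyhedral cones which contains all faces of its members and in which the intersection of any two members is a face of both; its support is the union of its members. A $T$-linearization of the trivial bundle on $X$ is a $T$-action on $X\times\mathbb A^1=\operatorname{Spec}R[z]$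 that commutes with the $\mathbb K^*$-action given by the grading of $R[z]$ by degree in $z$ and makes $X\times\mathbb A^1\to X$ equivariant. A point $x\in X$ is semistable with respect to it if there are $n>0$ and $f\in R$ such that $fz^n$ is $T$-invariant and $f(x)\neq0$. For $w\in M$ let $X^{ss}(w)$ be the set of semistable points of the linearization for which $z$ is homogeneous of weight $-w$ (so that $fz^n$ is invariant if and only if $f\in R_{nw}$). Then the following hold. 1. $\Sigma_T(X)$ is a quasifan in $M_{\mathbb Q}$ with support $\Omega_T(X)$. 2. Every $T$-linearization of the trivial bundle is the one given by a unique $w\in M$ as above, and $X^{ss}(w)\neq\emptyset$ if and only if $w\in\Omega_T(X)$. For all $w_1,w_2\in\Omega_T(X)\cap M$, $$X^{ss}(w_1)\subset X^{ss}(w_2)\iff\sigma_T(w_1)\supset\sigma_T(w_2),\qquad X^{ss}(w_1)=X^{ss}(w_2)\iff\sigma_T(w_1)=\sigma_T(w_2).$$ Thus $X^{ss}(w)\mapsto\sigma_T(w)$ is a well-defined inclusion-reversing bijection (with inclusion-reversing inverse) from the collection of nonempty sets of semistable points of $T$-linearizations of the trivial bundle onto $\Sigma_T(X)$. -/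

import Mathlib

open scoped TensorProduct

noncomputable section

namespace AffineGIT

/-! Convex geometry over the rational numbers. -/

section Quasifan

variable {V : Type*} [AddCommGroup V] [Module ℚ V]

/-- A quasifan: a finite collection of (not necessarily strictly convex) polyhedral cones,
that is, of finitely generated convex cones, which is closed under passing to faces and in
which the intersection of any two members is a face of both of them.
(A `PointedCone` of Mathlib is a convex cone containing the origin; it may contain lines.) -/
structure IsQuasifan (S : Set (PointedCone ℚ V)) : Prop where
  finite : S.Finite
  polyhedral : ∀ σ ∈ S, σ.FG
  face_mem : ∀ σ ∈ S, ∀ τ : PointedCone ℚ V, τ.IsFaceOf σ → τ ∈ S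
  inf_isFaceOf : ∀ σ ∈ S, ∀ τ ∈ S, (σ ⊓ τ).IsFaceOf σ ∧ (σ ⊓ τ).IsFaceOf τ

/-- The support of a collection of cones: the union of its members. -/
def support (S : Set (PointedCone ℚ V)) : Set V := ⋃ σ ∈ S, (σ : Set V)

end Quasifan

/-! The action of the torus `T = Spec K[M]` on `X = Spec R` is given by the `M`-grading `𝒜`
of `R`. Points of `X` are closed points, i.e. maximal ideals of `R`, and `f ∈ R` does not
vanish at `x` if and only if it does not lie in the maximal ideal `x`. -/

variable {K R M : Type*} [Field K] [CommRing R] [Algebra K R] [AddCommGroup M]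

/-- The canonical map from `M` to the rational vector space `M_ℚ = ℚ ⊗ M`. -/
def toRat (w : M) : ℚ ⊗[ℤ] M := 1 ⊗ₜ[ℤ] w

/-- The weight cone `Ω_T(X)`: the cone generated by all `w ∈ M` with `R_w ≠ 0`. -/
def weightCone (𝒜 : M → Submodule K R) : PointedCone ℚ (ℚ ⊗[ℤ] M) :=
  PointedCone.hull ℚ (toRat '' {w : M | 𝒜 w ≠ ⊥})

/-- The orbit monoid `S_T(x)`: all weights `w` for which there is an `f ∈ R_w` with
`f(x) ≠ 0`. -/
def orbitMonoid (𝒜 : M → Submodule K R) (x : MaximalSpectrum R) : Set M :=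
  {w : M | ∃ f ∈ 𝒜 w, f ∉ x.asIdeal}

/-- The orbit cone `ω_T(x)`: the cone generated by the orbit monoid of `x`. -/
def orbitCone (𝒜 : M → Submodule K R) (x : MaximalSpectrum R) :
    PointedCone ℚ (ℚ ⊗[ℤ] M) :=
  PointedCone.hull ℚ (toRat '' orbitMonoid 𝒜 x)

/-- The GIT-cone `σ_T(w)`: the intersection of all orbit cones containing `w`. -/
def gitCone (𝒜 : M → Submodule K R) (w : M) : PointedCone ℚ (ℚ ⊗[ℤ] M) :=
  sInf {ω | ∃ x : MaximalSpectrum R, ω = orbitCone 𝒜 x ∧ toRat w ∈ ω}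

/-- The collection `Σ_T(X)` of all GIT-cones `σ_T(w)`, `w ∈ Ω_T(X) ∩ M`. -/
def gitCones (𝒜 : M → Submodule K R) : Set (PointedCone ℚ (ℚ ⊗[ℤ] M)) :=
  {σ | ∃ w : M, toRat w ∈ weightCone 𝒜 ∧ σ = gitCone 𝒜 w}

/-! Linearizations of the trivial bundle. -/

open Polynomial in
/-- A `T`-linearization of the trivial bundle (the divisor `D = 0`) on `X = Spec R`: an action
of `T` on `X(0) = X × 𝔸¹ = Spec R[z]` which commutes with the action of `K^*` given by the
grading of `R[z]` by degree, and for which `X × 𝔸¹ → X` is equivariant. As for `X` itself,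
an action of `T` is given by an `M`-grading, here of the algebra `R[z]`. -/
@[ext]
structure TrivialLinearization [DecidableEq M] (𝒜 : M → Submodule K R) where
  /-- the homogeneous components of `R[z]` -/
  piece : M → Submodule K R[X]
  gradedMonoid : SetLike.GradedMonoid piece
  isInternal : DirectSum.IsInternal piece
  /-- the action commutes with the action of `K^*` -/
  commutes : ∀ (v : M) (p : R[X]), p ∈ piece v → ∀ n : ℕ, monomial n (p.coeff n) ∈ piece v
  /-- the projection `X × 𝔸¹ → X` is equivariant -/
  equivariant : ∀ (v : M) (f : R), f ∈ 𝒜 v → C f ∈ piece v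

namespace TrivialLinearization

/-- The set of semistable points of a linearization of the trivial bundle: all `x` for which
there are `n > 0` and a section `f` of the `n`-th power of the trivial bundle, i.e. `f ∈ R`,
such that `f(x) ≠ 0` and `f`, viewed as the function `f z ^ n` on `X × 𝔸¹`, is invariant,
i.e. homogeneous of weight zero. (The set `X_f` is affine since `X` is.) -/
def semistable [DecidableEq M] {𝒜 : M → Submodule K R} (L : TrivialLinearization 𝒜) :
    Set (MaximalSpectrum R) :=
  {x | ∃ n : ℕ, 0 < n ∧ ∃ f : R, Polynomial.monomial n f ∈ L.piece 0 ∧ f ∉ x.asIdeal}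

/-- The component of weight `v` of `R[z]` when `z` is given the weight `-w`. -/
def charPiece (𝒜 : M → Submodule K R) (w v : M) : Submodule K (Polynomial R) where
  carrier := {p | ∀ n : ℕ, p.coeff n ∈ 𝒜 (v + n • w)}
  add_mem' hp hq n := by
    rw [Polynomial.coeff_add]; exact add_mem (hp n) (hq n)
  zero_mem' n := by simp
  smul_mem' c p hp n := by
    rw [Polynomial.coeff_smul]; exact Submodule.smul_mem _ c (hp n)

lemma mem_charPiece {𝒜 : M → Submodule K R} {w v : M} {p : Polynomial R} :
    p ∈ charPiece 𝒜 w v ↔ ∀ n : ℕ, p.coeff n ∈ 𝒜 (v + n • w) := Iff.rfl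

lemma monomial_mem_charPiece {𝒜 : M → Submodule K R} {w v : M} {n : ℕ} {r : R} :
    Polynomial.monomial n r ∈ charPiece 𝒜 w v ↔ r ∈ 𝒜 (v + n • w) := by
  rw [mem_charPiece]
  constructor
  · intro h
    simpa using h n
  · intro h m
    rw [Polynomial.coeff_monomial]
    split_ifs with hm
    · exact hm ▸ h
    · exact zero_mem _

variable [DecidableEq M]

lemma charPiece_gradedMonoid (𝒜 : M → Submodule K R) [GradedAlgebra 𝒜] (w : M) :
    SetLike.GradedMonoid (charPiece 𝒜 w) where
  one_mem := by
    rw [← Polynomial.C_1, ← Polynomial.monomial_zero_left, monomial_mem_charPiece]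
    simpa using SetLike.GradedOne.one_mem (A := 𝒜)
  mul_mem u v p q hp hq := by
    intro n
    rw [Polynomial.coeff_mul]
    refine sum_mem fun ij hij => ?_
    have h := SetLike.GradedMul.mul_mem (A := 𝒜) (hp ij.1) (hq ij.2)
    have e : u + ij.1 • w + (v + ij.2 • w) = u + v + n • w := by
      rw [← Finset.HasAntidiagonal.mem_antidiagonal.1 hij, add_smul]; abel
    rwa [e] at h

lemma proj_coeff (𝒜 : M → Submodule K R) [GradedAlgebra 𝒜] (w : M)
    (f : DirectSum M fun v => charPiece 𝒜 w v) (v : M) (n : ℕ) :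
    GradedRing.proj 𝒜 (v + n • w)
        ((DirectSum.coeAddMonoidHom (charPiece 𝒜 w) f).coeff n) =
      (f v : Polynomial R).coeff n := by
  induction f using DirectSum.induction_on with
  | zero => simp
  | of u p =>
    rw [DirectSum.coeAddMonoidHom_of, GradedRing.proj_apply]
    by_cases h : u = v
    · subst h
      rw [DirectSum.decompose_of_mem_same 𝒜 (p.2 n), DirectSum.of_eq_same]
    · rw [DirectSum.decompose_of_mem_ne 𝒜 (p.2 n) (fun e => h (add_right_cancel e)),
        DirectSum.of_eq_of_ne _ _ _ (Ne.symm h)]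
      simp
  | add f g hf hg =>
    rw [map_add, Polynomial.coeff_add, map_add, hf, hg]
    simp

lemma charPiece_isInternal (𝒜 : M → Submodule K R) [GradedAlgebra 𝒜] (w : M) :
    DirectSum.IsInternal (charPiece 𝒜 w) := by
  constructor
  · rw [injective_iff_map_eq_zero]
    intro f hf
    refine DFinsupp.ext fun v => Subtype.ext (Polynomial.ext fun n => ?_)
    have h := proj_coeff 𝒜 w f v n
    rw [hf] at h
    simpa using h.symm
  · intro p
    classical
    rw [← AddMonoidHom.mem_mrange]
    induction p using Polynomial.induction_on' with
    | add p q hp hq => exact add_mem hp hq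
    | monomial n r =>
      rw [← DirectSum.sum_support_decompose 𝒜 r, map_sum]
      refine sum_mem fun a _ => ?_
      refine ⟨DirectSum.of (fun v => charPiece 𝒜 w v) (a - n • w)
        ⟨Polynomial.monomial n ((DirectSum.decompose 𝒜 r a : 𝒜 a) : R), ?_⟩, ?_⟩
      · rw [monomial_mem_charPiece, sub_add_cancel]
        exact SetLike.coe_mem _
      · rw [DirectSum.coeAddMonoidHom_of]

/-- The linearization of the trivial bundle given by the character `w`; its dual action on
`X × K` is `t · (x, z) = (t · x, χ^w(t) z)`. The coordinate function `z` of `X(0) = Spec R[z]`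
then has weight `-w`, so that `f z ^ n` is invariant if and only if `f ∈ R_{nw}`. -/
def ofCharacter (𝒜 : M → Submodule K R) [GradedAlgebra 𝒜] (w : M) :
    TrivialLinearization 𝒜 where
  piece := charPiece 𝒜 w
  gradedMonoid := charPiece_gradedMonoid 𝒜 w
  isInternal := charPiece_isInternal 𝒜 w
  commutes _ _ hp n := monomial_mem_charPiece.2 (hp n)
  equivariant v f hf := by
    rw [← Polynomial.monomial_zero_left, monomial_mem_charPiece]
    simpa using hf

end TrivialLinearization

/-- The set `X^ss(w)` of semistable points of the linearization given by `w ∈ M`. -/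
def semistableSet [DecidableEq M] (𝒜 : M → Submodule K R) [GradedAlgebra 𝒜] (w : M) :
    Set (MaximalSpectrum R) :=
  (TrivialLinearization.ofCharacter 𝒜 w).semistable

end AffineGIT

end

/-! Both the GIT-cones and the sets of semistable points are encoded by the orbit cones: $x\in
X^{ss}(w)$ means $w\in\omega_T(x)$ (`mem_semistableSet`), so the order-reversing correspondence is
formal. What needs geometry is the quasifan property. For a finite collection of cones, call the
intersection of the members containing $v$ the chamber of $v$. `isQuasifan_chambers` derives the
quasifan axioms from three inputs about the orbit cones.

Polyhedrality: the degrees of the homogeneous generators not vanishing at $x$ generate the orbit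
monoid of $x$, so there are finitely many orbit cones, each finitely generated, and their
intersections come from intersections of finitely generated monoids.

Faces (`exists_smul_sub_mem_orbitCone`): if $v\in\omega_T(x)$, then a point $y$, in effect a limit
in the orbit closure of $x$, has orbit monoid inside the smallest face containing a multiple of $v$.
Hence the chamber of $v$ lies in the smallest face of $\omega_T(x)$ containing $v$.

Sums (`mem_chamber_add`): if $u,u'$ lie in one chamber, every orbit cone containing $u+u'$ contains
$u$. This is a properness statement: a valuation centred at a point semistable for $u+u'$ produces a
point semistable for $v_0$ at which no new section of multiples of $u+u'$ becomes nonzero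
(`exists_specializing_point`).

For linearizations, commutation with $\mathbb K^*$ makes every component of $z$ a multiple $bz$.
Factors of nonzero homogeneous elements are homogeneous in a domain graded by a lattice, so $z$ has
a weight, and this weight determines the grading. -/

noncomputable section
namespace AffineGIT

/-! ### Chambers of a finite collection of cones -/

section Chambers

variable {V : Type*} [AddCommGroup V] [Module ℚ V]

/-- The intersection of all members of a collection of cones that contain a given vector. -/
def chamber (O : Set (PointedCone ℚ V)) (v : V) : PointedCone ℚ V :=
  sInf {ω | ω ∈ O ∧ v ∈ ω}

variable {O : Set (PointedCone ℚ V)}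

lemma mem_chamber {u v : V} : u ∈ chamber O v ↔ ∀ ω ∈ O, v ∈ ω → u ∈ ω := by
  simp [chamber, Submodule.mem_sInf]

lemma self_mem_chamber (v : V) : v ∈ chamber O v := mem_chamber.2 fun _ _ h => h

lemma chamber_le_of_mem {u v : V} (h : u ∈ chamber O v) : chamber O u ≤ chamber O v :=
  fun _ hz => mem_chamber.2 fun ω hω hv => mem_chamber.1 hz ω hω (mem_chamber.1 h ω hω hv)

lemma chamber_smul (v : V) {c : ℚ} (hc : 0 < c) : chamber O (c • v) = chamber O v := by
  simp only [chamber, PointedCone.smul_mem_iff _ hc]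

lemma finite_range_chamber (hO : O.Finite) : (Set.range (chamber O)).Finite := by
  refine (hO.finite_subsets.image sInf).subset ?_
  rintro _ ⟨v, rfl⟩
  exact ⟨_, fun ω hω => hω.1, rfl⟩

/-- If sums of vectors in a chamber generate a chamber containing the summands, then the
chambers of vectors in a chamber are faces of it. -/
lemma chamber_isFaceOf {u v : V}
    (hadd : ∀ x ∈ chamber O v, ∀ y ∈ chamber O v, x ∈ chamber O (x + y))
    (hu : u ∈ chamber O v) : (chamber O u).IsFaceOf (chamber O v) where
  le := chamber_le_of_mem hu
  mem_of_smul_add_mem {x y a} hx hy ha h := by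
    rw [← PointedCone.smul_mem_iff _ ha]
    exact chamber_le_of_mem h (hadd _ (PointedCone.smul_mem _ ha.le hx) _ hy)

/-- Among the finitely many chambers of vectors of `C`, take a maximal one, that of `u`. For `z` in
`C`, the chamber of `z + u` contains that of `u`, so it equals it, and it contains `z`. Applied both
to faces and to intersections of chambers. -/
lemma eq_chamber_of_forall_le (hO : O.Finite) {v : V}
    (hadd : ∀ x ∈ chamber O v, ∀ y ∈ chamber O v, x ∈ chamber O (x + y))
    {C : PointedCone ℚ V} (hC : C ≤ chamber O v) (h : ∀ u ∈ C, chamber O u ≤ C) :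
    ∃ u ∈ C, C = chamber O u := by
  obtain ⟨σ, ⟨⟨u, hu, rfl⟩, hmax⟩⟩ :=
    ((finite_range_chamber hO).subset (Set.image_subset_range (chamber O) C)).exists_maximal
      ⟨_, 0, C.zero_mem, rfl⟩
  refine ⟨u, hu, le_antisymm (fun z hz => ?_) (h u hu)⟩
  have hzu : z + u ∈ C := C.add_mem hz hu
  have h₁ : chamber O u ≤ chamber O (z + u) := by
    refine chamber_le_of_mem ?_
    rw [add_comm]
    exact hadd _ (hC hu) _ (hC hz)
  exact hmax ⟨_, hzu, rfl⟩ h₁ (hadd _ (hC hz) _ (hC hu))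

/-- Raising the constant only adds a nonnegative multiple of `v`, so the largest of the finitely
many constants serves all cones at once. -/
lemma exists_smul_sub_mem_chamber (hO : O.Finite)
    (hface : ∀ ω ∈ O, ∀ v ∈ ω, ∀ u ∈ chamber O v, ∃ c : ℚ, c • v - u ∈ ω)
    {u v : V} (hu : u ∈ chamber O v) : ∃ c : ℚ, c • v - u ∈ chamber O v := by
  choose! c hc using hface
  obtain ⟨b, hb⟩ := (hO.image fun ω => c ω v u).bddAbove
  refine ⟨b, mem_chamber.2 fun ω hω hv => ?_⟩
  have h₁ : b • v - u = (b - c ω v u) • v + (c ω v u • v - u) := by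
    rw [sub_smul]; abel
  rw [h₁]
  exact ω.add_mem (PointedCone.smul_mem _ (sub_nonneg.2 (hb ⟨ω, hω, rfl⟩)) hv)
    (hc ω hω v hv u hu)

/-- A vector `z` of the chamber of `u` is a summand of a nonnegative multiple of `u`; a face
containing the sum contains the summand. -/
lemma chamber_le_face (hO : O.Finite)
    (hface : ∀ ω ∈ O, ∀ v ∈ ω, ∀ u ∈ chamber O v, ∃ c : ℚ, c • v - u ∈ ω)
    {v u : V} {τ : PointedCone ℚ V} (hτ : τ.IsFaceOf (chamber O v)) (hu : u ∈ τ) :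
    chamber O u ≤ τ := by
  intro z hz
  obtain ⟨c, hc⟩ := exists_smul_sub_mem_chamber hO hface hz
  have huv := chamber_le_of_mem (hτ.le hu)
  -- The absolute value keeps the multiple of `u` inside the cone `τ`.
  have hc' : (|c| : ℚ) • u - z ∈ chamber O u := by
    have h₁ : (|c| : ℚ) • u - z = (|c| - c) • u + (c • u - z) := by
      rw [sub_smul]; abel
    rw [h₁]
    exact (chamber O u).add_mem (PointedCone.smul_mem _ (sub_nonneg.2 (le_abs_self c))
      (self_mem_chamber u)) hc
  refine hτ.mem_of_add_mem_left (huv hz) (huv hc') ?_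
  rw [add_sub_cancel]
  exact PointedCone.smul_mem _ (abs_nonneg c) hu

/-- The chambers of a finite collection of cones form a quasifan, provided that the chambers are
polyhedral, lie in the relevant faces of the cones, and are compatible with sums. -/
theorem isQuasifan_chambers (hO : O.Finite)
    (hfg : ∀ v ∈ support O, (chamber O v).FG)
    (hface : ∀ ω ∈ O, ∀ v ∈ ω, ∀ u ∈ chamber O v, ∃ c : ℚ, c • v - u ∈ ω)
    (hadd : ∀ v ∈ support O, ∀ x ∈ chamber O v, ∀ y ∈ chamber O v, x ∈ chamber O (x + y)) :
    IsQuasifan (chamber O '' support O) := by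
  have hsupp : ∀ v ∈ support O, ∀ u ∈ chamber O v, u ∈ support O := by
    intro v hv u hu
    simp only [support, Set.mem_iUnion] at hv ⊢
    obtain ⟨ω, hω, hv⟩ := hv
    exact ⟨ω, hω, mem_chamber.1 hu ω hω hv⟩
  constructor
  · exact (finite_range_chamber hO).subset (Set.image_subset_range _ _)
  · rintro _ ⟨v, hv, rfl⟩
    exact hfg v hv
  · rintro _ ⟨v, hv, rfl⟩ τ hτ
    obtain ⟨u, hu, rfl⟩ := eq_chamber_of_forall_le hO (hadd v hv) hτ.le
      fun u hu => chamber_le_face hO hface hτ hu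
    exact ⟨u, hsupp v hv u (hτ.le hu), rfl⟩
  · rintro _ ⟨v, hv, rfl⟩ _ ⟨v', hv', rfl⟩
    obtain ⟨u, hu, h⟩ := eq_chamber_of_forall_le hO (hadd v hv)
      (C := chamber O v ⊓ chamber O v') inf_le_left
      fun u hu => le_inf (chamber_le_of_mem hu.1) (chamber_le_of_mem hu.2)
    rw [h]
    exact ⟨chamber_isFaceOf (hadd v hv) hu.1, chamber_isFaceOf (hadd v' hv') hu.2⟩

lemma support_chambers : support (chamber O '' support O) = support O := by
  ext u
  simp only [support, Set.mem_iUnion, SetLike.mem_coe, Set.mem_image]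
  constructor
  · rintro ⟨_, ⟨v, ⟨ω, hω, hv⟩, rfl⟩, hu⟩
    exact ⟨ω, hω, mem_chamber.1 hu ω hω hv⟩
  · intro hu
    exact ⟨_, ⟨u, hu, rfl⟩, self_mem_chamber u⟩

end Chambers

/-! ### Rational cones generated by submonoids of a lattice -/

section Lattice

variable {M : Type*} [AddCommGroup M]

/-- The canonical map to the associated rational vector space, as an additive map. -/
def toRatHom (M : Type*) [AddCommGroup M] : M →+ ℚ ⊗[ℤ] M :=
  (TensorProduct.mk ℤ ℚ M 1).toAddMonoidHom

lemma toRat_add (u v : M) : toRat (u + v) = toRat u + toRat v := (toRatHom M).map_add u v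

lemma toRat_nsmul (n : ℕ) (u : M) : toRat (n • u) = (n : ℚ) • toRat u := by
  rw [Nat.cast_smul_eq_nsmul]; exact (toRatHom M).map_nsmul n u

lemma toRat_zero : toRat (0 : M) = 0 := (toRatHom M).map_zero

lemma exists_smul_eq_toRat (v : ℚ ⊗[ℤ] M) :
    ∃ n : ℕ, 0 < n ∧ ∃ w : M, (n : ℚ) • v = toRat w := by
  induction v using TensorProduct.induction_on with
  | zero => exact ⟨1, one_pos, 0, by simp [toRat_zero]⟩
  | tmul q m =>
    refine ⟨q.den, q.den_pos, q.num • m, ?_⟩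
    rw [TensorProduct.smul_tmul', smul_eq_mul, mul_comm, Rat.mul_den_eq_num, toRat,
      ← TensorProduct.smul_tmul, zsmul_eq_mul, mul_one]
  | add v v' h h' =>
    obtain ⟨n, hn, w, hw⟩ := h
    obtain ⟨n', hn', w', hw'⟩ := h'
    refine ⟨n * n', Nat.mul_pos hn hn', n' • w + n • w', ?_⟩
    rw [toRat_add, toRat_nsmul, toRat_nsmul, ← hw, ← hw', smul_add, smul_smul, smul_smul,
      Nat.cast_mul, mul_comm (n : ℚ)]

lemma toRat_injective [Module.Free ℤ M] : Function.Injective (toRat : M → ℚ ⊗[ℤ] M) := by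
  have h : Function.Injective (Algebra.linearMap ℤ ℚ) := Int.cast_injective
  intro u v huv
  refine (TensorProduct.lid ℤ M).symm.injective
    (Module.Flat.rTensor_preserves_injective_linearMap (M := M) _ h ?_)
  simpa [toRat] using huv

/-- The convex cone generated by a submonoid of the lattice. -/
def monoidCone (S : AddSubmonoid M) : PointedCone ℚ (ℚ ⊗[ℤ] M) :=
  PointedCone.hull ℚ (toRat '' (S : Set M))

/-- Clearing denominators turns a nonnegative rational combination into an element of the monoid.
This is how statements about cones become statements about homogeneous functions. -/
lemma mem_monoidCone {S : AddSubmonoid M} {v : ℚ ⊗[ℤ] M} :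
    v ∈ monoidCone S ↔ ∃ n : ℕ, 0 < n ∧ ∃ w ∈ S, (n : ℚ) • v = toRat w := by
  constructor
  · intro h
    induction h using Submodule.span_induction with
    | mem _ h =>
      obtain ⟨w, hw, rfl⟩ := h
      exact ⟨1, one_pos, w, hw, by simp⟩
    | zero => exact ⟨1, one_pos, 0, S.zero_mem, by simp [toRat_zero]⟩
    | add v v' _ _ h h' =>
      obtain ⟨n, hn, w, hw, e⟩ := h
      obtain ⟨n', hn', w', hw', e'⟩ := h'
      refine ⟨n * n', Nat.mul_pos hn hn', n' • w + n • w',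
        S.add_mem (S.nsmul_mem hw _) (S.nsmul_mem hw' _), ?_⟩
      rw [toRat_add, toRat_nsmul, toRat_nsmul, ← e, ← e', smul_add, smul_smul, smul_smul,
        Nat.cast_mul, mul_comm (n : ℚ)]
    | smul a v _ h =>
      obtain ⟨n, hn, w, hw, e⟩ := h
      obtain ⟨a, ha⟩ := a
      -- The numerator of `a` is nonnegative, so `toNat` loses nothing.
      refine ⟨a.den * n, Nat.mul_pos a.den_pos hn, a.num.toNat • w, S.nsmul_mem hw _, ?_⟩
      have h₁ : ((a.num.toNat : ℕ) : ℚ) = a.den * a := by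
        rw [mul_comm, Rat.mul_den_eq_num]
        exact_mod_cast Int.toNat_of_nonneg (Rat.num_nonneg.2 ha)
      rw [toRat_nsmul, ← e, h₁]
      change ((a.den * n : ℕ) : ℚ) • a • v = _
      rw [smul_smul, smul_smul]
      push_cast
      congr 1
      ring
  · rintro ⟨n, hn, w, hw, e⟩
    rw [← PointedCone.smul_mem_iff _ (Nat.cast_pos.2 hn : (0 : ℚ) < n), e]
    exact PointedCone.subset_hull ⟨w, hw, rfl⟩

lemma toRat_mem_monoidCone [Module.Free ℤ M] {S : AddSubmonoid M} {w : M} :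
    toRat w ∈ monoidCone S ↔ ∃ n : ℕ, 0 < n ∧ n • w ∈ S := by
  rw [mem_monoidCone]
  refine exists_congr fun n => and_congr_right fun _ => ?_
  rw [← toRat_nsmul]
  exact ⟨fun ⟨u, hu, e⟩ => toRat_injective e ▸ hu, fun h => ⟨_, h, rfl⟩⟩

lemma monoidCone_inf [Module.Free ℤ M] (S T : AddSubmonoid M) :
    monoidCone (S ⊓ T) = monoidCone S ⊓ monoidCone T := by
  refine le_antisymm (le_inf (Submodule.span_mono ?_) (Submodule.span_mono ?_)) ?_
  · exact Set.image_mono fun _ h => h.1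
  · exact Set.image_mono fun _ h => h.2
  · rintro v ⟨h, h'⟩
    obtain ⟨n, hn, w, hw, e⟩ := mem_monoidCone.1 h
    obtain ⟨n', hn', w', hw', e'⟩ := mem_monoidCone.1 h'
    have h₁ : n' • w = n • w' := by
      apply toRat_injective
      rw [toRat_nsmul, toRat_nsmul, ← e, ← e', smul_comm]
    refine mem_monoidCone.2 ⟨n' * n, Nat.mul_pos hn' hn, n' • w,
      ⟨S.nsmul_mem hw _, ?_⟩, ?_⟩
    · rw [h₁]
      exact T.nsmul_mem hw' _
    · rw [toRat_nsmul, ← e, smul_smul, Nat.cast_mul]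

lemma monoidCone_top : monoidCone (⊤ : AddSubmonoid M) = ⊤ := by
  rw [eq_top_iff]
  intro v _
  obtain ⟨n, hn, w, e⟩ := exists_smul_eq_toRat v
  exact mem_monoidCone.2 ⟨n, hn, w, trivial, e⟩

lemma monoidCone_closure (s : Set M) :
    monoidCone (AddSubmonoid.closure s) = PointedCone.hull ℚ (toRat '' s) := by
  refine le_antisymm (Submodule.span_le.2 ?_)
    (Submodule.span_mono (Set.image_mono AddSubmonoid.subset_closure))
  rintro _ ⟨w, hw, rfl⟩
  induction hw using AddSubmonoid.closure_induction with
  | mem w hw => exact PointedCone.subset_hull ⟨w, hw, rfl⟩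
  | zero => rw [toRat_zero]; exact Submodule.zero_mem _
  | add u v _ _ hu hv => rw [toRat_add]; exact Submodule.add_mem _ hu hv

lemma monoidCone_fg {S : AddSubmonoid M} (hS : S.FG) : (monoidCone S).FG := by
  obtain ⟨s, rfl⟩ := hS
  rw [monoidCone_closure]
  exact Submodule.fg_span (s.finite_toSet.image _)

/-- The intersection of two finitely generated submonoids of an abelian group is finitely
generated. -/
lemma fg_inf {S T : AddSubmonoid M} (hS : S.FG) (hT : T.FG) : (S ⊓ T).FG := by
  obtain ⟨s, rfl⟩ := hS
  obtain ⟨t, rfl⟩ := hT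
  let f : (s → ℕ) →+ M :=
    { toFun := fun a => ∑ i, a i • (i : M)
      map_zero' := by simp
      map_add' := fun a b => by simp [add_smul, Finset.sum_add_distrib] }
  let g : (t → ℕ) →+ M :=
    { toFun := fun a => ∑ i, a i • (i : M)
      map_zero' := by simp
      map_add' := fun a b => by simp [add_smul, Finset.sum_add_distrib] }
  have key : ∀ (r : Finset M) (x : M),
      x ∈ AddSubmonoid.closure (r : Set M) ↔ ∃ a : r → ℕ, ∑ i, a i • (i : M) = x := by
    intro r x
    rw [← Submodule.span_nat_eq_addSubmonoidClosure, Submodule.mem_toAddSubmonoid]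
    have := Submodule.mem_span_range_iff_exists_fun (R := ℕ) (v := fun i : r => (i : M)) (x := x)
    simpa using this
  -- The intersection is the image of the fibre product of the free monoids on `s` and `t` over `M`,
  -- an equalizer of two homomorphisms.
  have h := AddSubmonoid.fg_eqLocusM (f.comp (AddMonoidHom.fst _ (t → ℕ)))
    (g.comp (AddMonoidHom.snd (s → ℕ) _))
  have h' := h.map (f.comp (AddMonoidHom.fst _ (t → ℕ)))
  convert h' using 1
  ext x
  rw [AddSubmonoid.mem_inf, key, key, AddSubmonoid.mem_map]
  constructor
  · rintro ⟨⟨a, ha⟩, b, hb⟩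
    exact ⟨(a, b), ha.trans hb.symm, ha⟩
  · rintro ⟨⟨a, b⟩, hab, ha⟩
    exact ⟨⟨a, ha⟩, b, hab.symm.trans ha⟩

/-- Intersecting the monoids instead of the cones gives polyhedrality without duality of cones. -/
lemma sInf_monoidCone_fg [Module.Free ℤ M] [Module.Finite ℤ M] {P : Set (AddSubmonoid M)}
    (hP : P.Finite) (hfg : ∀ S ∈ P, S.FG) : (sInf (monoidCone '' P)).FG := by
  suffices ∃ S : AddSubmonoid M, S.FG ∧ sInf (monoidCone '' P) = monoidCone S by
    obtain ⟨S, hS, h⟩ := this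
    exact h ▸ monoidCone_fg hS
  induction P, hP using Set.Finite.induction_on with
  | empty =>
    refine ⟨⊤, ?_, by simp [monoidCone_top]⟩
    have : AddGroup.FG M := Module.Finite.iff_addGroup_fg.1 inferInstance
    exact AddMonoid.FG.fg_top
  | insert _ _ ih =>
    obtain ⟨S, hS, h⟩ := ih fun S hS => hfg S (Set.mem_insert_of_mem _ hS)
    exact ⟨_, fg_inf (hfg _ (Set.mem_insert _ _)) hS, by
      rw [Set.image_insert_eq, sInf_insert, h, monoidCone_inf]⟩

end Lattice

/-! ### Properness by valuations -/

section Valuations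

variable {K R M : Type*} [Field K] [CommRing R] [Algebra K R] [AddCommGroup M]
  [DecidableEq M] (𝒜 : M → Submodule K R) [GradedAlgebra 𝒜]

/-- A property of the homogeneous components of the elements of an ideal that is stable under
addition can be checked on multiples of the generators. -/
lemma span_mul_induction {A : Type*} [CommRing A] {s : Set A} {P : A → Prop}
    (zero : P 0) (add : ∀ a b, P a → P b → P (a + b)) (mul : ∀ a, ∀ b ∈ s, P (a * b))
    {y : A} (hy : y ∈ Ideal.span s) : P y := by
  suffices ∀ a, P (a * y) by simpa using this 1
  induction hy using Submodule.span_induction with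
  | mem b hb => exact fun a => mul a b hb
  | zero => simpa using zero
  | add b c _ _ hb hc => exact fun a => by rw [mul_add]; exact add _ _ (hb a) (hc a)
  | smul c b _ hb => exact fun a => by rw [smul_eq_mul, ← mul_assoc]; exact hb _

lemma pow_mem_smul {w : M} {f : R} (hf : f ∈ 𝒜 w) (k : ℕ) : f ^ k ∈ 𝒜 (k • w) :=
  SetLike.pow_mem_graded k hf

/-- A point `x` and a homogeneous function `f` with `f(x) ≠ 0` define a local ring of fractions
of degree zero, which is dominated by a valuation ring. -/
lemma exists_valuation [IsDomain R] {x : Ideal R} [x.IsPrime] {w : M} {f : R}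
    (hf : f ∈ 𝒜 w) (hfx : f ∉ x) :
    ∃ V : ValuationSubring (FractionRing R),
      (∀ g ∈ 𝒜 0, V.valuation (algebraMap R _ g) ≤ 1) ∧
      ∀ k : ℕ, ∀ g ∈ 𝒜 (k • w), g ∈ x →
        V.valuation (algebraMap R _ g) < V.valuation (algebraMap R _ f) ^ k := by
  set ι := algebraMap R (FractionRing R) with hι
  have hinj : Function.Injective ι := IsFractionRing.injective R _
  have hne : ∀ {q}, q ∉ x → ι q ≠ 0 := fun hq h => hq (by
    rw [(map_eq_zero_iff ι hinj).1 h]; exact x.zero_mem)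
  have hmul : ∀ {k l : ℕ} {p q : R}, p ∈ 𝒜 (k • w) → q ∈ 𝒜 (l • w) → p * q ∈ 𝒜 ((k + l) • w) := by
    intro k l p q hp hq
    rw [add_smul]
    exact SetLike.mul_mem_graded hp hq
  have hone : (1 : R) ∈ 𝒜 (0 • w) := by rw [zero_smul]; exact SetLike.one_mem_graded 𝒜
  have hnot : ∀ {p q : R}, p ∉ x → q ∉ x → p * q ∉ x :=
    fun hp hq h => (Ideal.IsPrime.mem_or_mem ‹_› h).elim hp hq
  let A : Subring (FractionRing R) :=
    { carrier := {a | ∃ k : ℕ, ∃ p ∈ 𝒜 (k • w), ∃ q ∈ 𝒜 (k • w), q ∉ x ∧ a * ι q = ι p}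
      mul_mem' := by
        rintro a b ⟨k, p, hp, q, hq, hqx, e⟩ ⟨l, p', hp', q', hq', hqx', e'⟩
        refine ⟨k + l, _, hmul hp hp', _, hmul hq hq', hnot hqx hqx', ?_⟩
        rw [map_mul, map_mul, ← e, ← e']; ring
      one_mem' := ⟨0, 1, hone, 1, hone, x.one_notMem, by simp⟩
      add_mem' := by
        rintro a b ⟨k, p, hp, q, hq, hqx, e⟩ ⟨l, p', hp', q', hq', hqx', e'⟩
        refine ⟨k + l, p * q' + q * p', add_mem (hmul hp hq') (hmul hq hp'), _, hmul hq hq',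
          hnot hqx hqx', ?_⟩
        rw [map_mul, map_add, map_mul, map_mul, ← e, ← e']; ring
      zero_mem' := ⟨0, 0, zero_mem _, 1, hone, x.one_notMem, by simp⟩
      neg_mem' := by
        rintro a ⟨k, p, hp, q, hq, hqx, e⟩
        exact ⟨k, -p, neg_mem hp, q, hq, hqx, by rw [map_neg, ← e]; ring⟩ }
  let I : Ideal A :=
    { carrier := {a | ∃ k : ℕ, ∃ p ∈ 𝒜 (k • w), ∃ q ∈ 𝒜 (k • w), p ∈ x ∧ q ∉ x ∧
        (a : FractionRing R) * ι q = ι p}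
      add_mem' := by
        rintro a b ⟨k, p, hp, q, hq, hpx, hqx, e⟩ ⟨l, p', hp', q', hq', hpx', hqx', e'⟩
        refine ⟨k + l, p * q' + q * p', add_mem (hmul hp hq') (hmul hq hp'), _, hmul hq hq',
          x.add_mem (x.mul_mem_right _ hpx) (x.mul_mem_left _ hpx'), hnot hqx hqx', ?_⟩
        rw [map_mul, map_add, map_mul, map_mul, ← e, ← e', Subring.coe_add]; ring
      zero_mem' := ⟨0, 0, zero_mem _, 1, hone, x.zero_mem, x.one_notMem, by simp⟩
      smul_mem' := by
        rintro ⟨a, l, p', hp', q', hq', hqx', e'⟩ b ⟨k, p, hp, q, hq, hpx, hqx, e⟩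
        refine ⟨l + k, _, hmul hp' hp, _, hmul hq' hq, x.mul_mem_left _ hpx, hnot hqx' hqx, ?_⟩
        rw [map_mul, map_mul, ← e, smul_eq_mul, Subring.coe_mul]
        linear_combination (b * ι q : FractionRing R) * e' }
  have hI : I ≠ ⊤ := by
    rw [Ideal.ne_top_iff_one]
    rintro ⟨k, p, hp, q, hq, hpx, hqx, e⟩
    rw [Subring.coe_one, one_mul] at e
    exact hqx (hinj e ▸ hpx)
  obtain ⟨V, hAV, hIV⟩ := Ideal.image_subset_nonunits_valuationSubring I hI
  refine ⟨V, fun g hg => ?_, fun k g hg hgx => ?_⟩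
  · rw [V.valuation_le_one_iff]
    exact hAV ⟨0, g, by rwa [zero_smul], 1, hone, x.one_notMem, by simp⟩
  · have hfk : f ^ k ∉ x := fun h => hfx (Ideal.IsPrime.mem_of_pow_mem ‹_› _ h)
    have e : ι g / ι (f ^ k) * ι (f ^ k) = ι g := div_mul_cancel₀ _ (hne hfk)
    -- The fraction lies in the proper ideal `I`, which the valuation ring `V` was chosen to
    -- dominate.
    have h : ι g / ι (f ^ k) ∈ V.nonunits :=
      hIV ⟨⟨ι g / ι (f ^ k), k, g, hg, _, pow_mem_smul 𝒜 hf k, hfk, e⟩,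
        ⟨k, g, hg, _, pow_mem_smul 𝒜 hf k, hgx, hfk, e⟩, rfl⟩
    rw [ValuationSubring.mem_nonunits_iff, map_div₀] at h
    rw [← map_pow, ← map_pow]
    exact (div_lt_one₀ (zero_lt_iff.2 ((map_ne_zero _).2 (hne hfk)))).1 h

/-- In the ring of sections of multiples of a weight `w`, a valuation that is bounded by one on
degree zero elements is maximal, relative to the degree, on a nonzero section of positive
degree. -/
lemma exists_maximal_section [IsDomain R] [IsNoetherianRing R] {Γ : Type*}
    [LinearOrderedCommGroupWithZero Γ] (v : Valuation R Γ) (hv : ∀ r, v r = 0 → r = 0)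
    (h₀ : ∀ g ∈ 𝒜 0, v g ≤ 1) {w : M} (hw : 𝒜 w ≠ ⊥) :
    ∃ m : ℕ, 0 < m ∧ ∃ h ∈ 𝒜 (m • w), h ≠ 0 ∧
      ∀ k : ℕ, ∀ g ∈ 𝒜 (k • w), v g ^ m ≤ v h ^ k := by
  classical
  -- The variable records `k`, which the weight `k • w` alone does not determine when `w = 0`.
  let s : Set (Polynomial R) :=
    {p | ∃ k : ℕ, 0 < k ∧ ∃ g ∈ 𝒜 (k • w), p = Polynomial.monomial k g}
  obtain ⟨t, hts, ht⟩ := (Submodule.fg_span_iff_fg_span_finset_subset s).1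
    (IsNoetherian.noetherian (Ideal.span s))
  choose! d hd c hc e using fun p (hp : p ∈ t) => hts hp
  obtain ⟨a, ha, ha0⟩ := Submodule.exists_mem_ne_zero_of_ne_bot hw
  have hex : ∃ p ∈ t, c p ≠ 0 := by
    by_contra! H
    have h₁ : Polynomial.monomial 1 a ∈ Ideal.span s :=
      Ideal.subset_span ⟨1, one_pos, a, by rwa [one_smul], rfl⟩
    have h₂ : Submodule.span (Polynomial R) (t : Set (Polynomial R)) = ⊥ := by
      rw [Submodule.span_eq_bot]
      intro p hp
      rw [e p hp, H p hp, Polynomial.monomial_zero_right]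
    have h₃ : Polynomial.monomial 1 a = 0 := by
      rw [Ideal.span, ht, h₂] at h₁
      exact h₁
    exact ha0 ((Polynomial.monomial_eq_zero_iff _ _).1 h₃)
  obtain ⟨p₀, hp₀, hcp₀⟩ := hex
  set D := ∏ p ∈ t, d p with hD
  have hDpos : 0 < D := Finset.prod_pos hd
  have hdvd : ∀ p ∈ t, d p ∣ D := fun p hp => Finset.dvd_prod_of_mem d hp
  -- The aim is to maximize the `d p`-th root of `v (c p)`; raising to the power `D` avoids roots.
  obtain ⟨q, hq, hmax⟩ := t.exists_max_image (fun p => v (c p) ^ (D / d p)) ⟨p₀, hp₀⟩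
  have hcomp : ∀ p ∈ t, v (c p) ^ d q ≤ v (c q) ^ d p := by
    intro p hp
    have h₁ := pow_le_pow_left₀ zero_le (hmax p hp) (d p * d q)
    rw [← pow_mul, ← pow_mul, ← mul_assoc, Nat.div_mul_cancel (hdvd p hp), mul_comm (d p),
      ← mul_assoc, Nat.div_mul_cancel (hdvd q hq), mul_comm D, mul_comm D, pow_mul, pow_mul] at h₁
    exact (pow_le_pow_iff_left₀ zero_le zero_le hDpos.ne').1 h₁
  refine ⟨d q, hd q hq, c q, hc q hq, fun h => ?_, fun k => ?_⟩
  · have h₁ := hcomp p₀ hp₀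
    rw [h, map_zero, zero_pow (hd p₀ hp₀).ne', le_zero_iff, pow_eq_zero_iff (hd q hq).ne'] at h₁
    exact hcp₀ (hv _ h₁)
  induction k using Nat.strong_induction_on with
  | _ k ih =>
  intro g hg
  rcases k.eq_zero_or_pos with rfl | hk
  · rw [pow_zero]
    exact pow_le_one₀ zero_le (h₀ g (by rwa [zero_smul] at hg))
  have hmem : Polynomial.monomial k g ∈ Ideal.span (t : Set (Polynomial R)) := by
    rw [Ideal.span, ← ht]
    exact Ideal.subset_span ⟨k, hk, g, hg, rfl⟩
  -- Expand the monomial in the generators and keep the coefficient of index `k` in weight `k • w`.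
  -- Each term is then a section of smaller index, bounded by induction, times some `c p`, bounded
  -- by `hcomp`.
  have key : v (GradedRing.proj 𝒜 (k • w) ((Polynomial.monomial k g).coeff k)) ^ d q ≤
      v (c q) ^ k := by
    refine span_mul_induction (s := (t : Set (Polynomial R)))
      (P := fun y => v (GradedRing.proj 𝒜 (k • w) (y.coeff k)) ^ d q ≤ v (c q) ^ k) ?_ ?_ ?_ hmem
    · simp [zero_pow (hd q hq).ne']
    · intro y z hy hz
      rw [Polynomial.coeff_add, map_add]
      rcases le_total (v (GradedRing.proj 𝒜 (k • w) (y.coeff k)))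
        (v (GradedRing.proj 𝒜 (k • w) (z.coeff k))) with h | h
      · exact (pow_le_pow_left₀ zero_le ((v.map_add _ _).trans (max_le h le_rfl)) _).trans hz
      · exact (pow_le_pow_left₀ zero_le ((v.map_add _ _).trans (max_le le_rfl h)) _).trans hy
    · intro y p hp
      rw [e p hp]
      by_cases hpk : d p ≤ k
      · obtain ⟨j, rfl⟩ := Nat.exists_eq_add_of_le' hpk
        rw [Polynomial.coeff_mul_monomial, add_smul, GradedRing.proj_apply,
          DirectSum.coe_decompose_mul_add_of_right_mem 𝒜 (hc p hp), map_mul, mul_pow, pow_add]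
        exact mul_le_mul' (ih j (Nat.lt_add_of_pos_right (hd p hp)) _ (SetLike.coe_mem _))
          (hcomp p hp)
      · rw [Polynomial.coeff_mul, Finset.sum_eq_zero, map_zero, map_zero,
          zero_pow (hd q hq).ne']
        · exact zero_le
        · intro ij hij
          rw [Polynomial.coeff_monomial, if_neg, mul_zero]
          intro h
          have := Finset.HasAntidiagonal.mem_antidiagonal.1 hij
          omega
  rwa [Polynomial.coeff_monomial, if_pos rfl, GradedRing.proj_apply,
    DirectSum.decompose_of_mem_same 𝒜 hg] at key

/-- Let `x` be a point at which some section of weight `w` does not vanish, and let `w₀` be a weight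
of the algebra. Then there is a point `y` at which some section of a positive multiple of `w₀`
does not vanish, such that all sections of multiples of `w` vanishing at `x` vanish at `y`. -/
lemma exists_specializing_point [IsDomain R] [Algebra.FiniteType K R] (x : MaximalSpectrum R)
    {w w₀ : M} (hw : w ∈ orbitMonoid 𝒜 x) (hw₀ : 𝒜 w₀ ≠ ⊥) :
    ∃ y : MaximalSpectrum R, (∃ m : ℕ, 0 < m ∧ m • w₀ ∈ orbitMonoid 𝒜 y) ∧
      ∀ k : ℕ, ∀ g ∈ 𝒜 (k • w), g ∈ x.asIdeal → g ∈ y.asIdeal := by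
  have : IsNoetherianRing R := Algebra.FiniteType.isNoetherianRing K R
  have : IsJacobsonRing R := isJacobsonRing_of_finiteType (A := K)
  have := x.isMaximal.isPrime
  obtain ⟨f, hf, hfx⟩ := hw
  obtain ⟨V, hV₀, hV⟩ := exists_valuation 𝒜 hf hfx
  let v : Valuation R _ := V.valuation.comap (algebraMap R (FractionRing R))
  have hv : ∀ r, v r = 0 → r = 0 := fun r hr =>
    (map_eq_zero_iff _ (IsFractionRing.injective R (FractionRing R))).1
      ((map_eq_zero V.valuation).1 hr)
  obtain ⟨m, hm, h, hh, hh0, hmax⟩ := exists_maximal_section 𝒜 v hv hV₀ hw₀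
  have hvh : 0 < v h := zero_lt_iff.2 fun H => hh0 (hv _ H)
  let J : Ideal R := Ideal.span {g | g ∈ x.asIdeal ∧ ∃ k : ℕ, g ∈ 𝒜 (k • w)}
  -- The strict inequality fails for powers of `h`, so it keeps `h` out of the radical of `J`; the
  -- Jacobson property then supplies the point.
  have hJ : ∀ y ∈ J, ∀ k : ℕ, v (GradedRing.proj 𝒜 (k • w₀) y) ^ m < v h ^ k := by
    intro y hy k
    refine span_mul_induction (P := fun y => v (GradedRing.proj 𝒜 (k • w₀) y) ^ m < v h ^ k)
      ?_ ?_ ?_ hy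
    · rw [map_zero, map_zero, zero_pow hm.ne']
      exact pow_pos hvh k
    · intro y z hy hz
      rw [map_add]
      rcases le_total (v (GradedRing.proj 𝒜 (k • w₀) y))
        (v (GradedRing.proj 𝒜 (k • w₀) z)) with h | h
      · exact (pow_le_pow_left₀ zero_le ((v.map_add _ _).trans (max_le h le_rfl)) _).trans_lt hz
      · exact (pow_le_pow_left₀ zero_le ((v.map_add _ _).trans (max_le le_rfl h)) _).trans_lt hy
    · rintro r g ⟨hgx, j, hg⟩
      have h₁ : GradedRing.proj 𝒜 (k • w₀) (r * g) =
          GradedRing.proj 𝒜 (k • w₀ - j • w) r * g := by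
        have := DirectSum.coe_decompose_mul_add_of_right_mem 𝒜 (a := r) (i := k • w₀ - j • w) hg
        rwa [sub_add_cancel] at this
      rw [h₁]
      set r' := GradedRing.proj 𝒜 (k • w₀ - j • w) r with hr'
      by_cases hr0 : v r' = 0
      · rw [map_mul, hr0, zero_mul, zero_pow hm.ne']
        exact pow_pos hvh k
      · have h₂ : r' * f ^ j ∈ 𝒜 (k • w₀) := by
          have := SetLike.mul_mem_graded (A := 𝒜) (SetLike.coe_mem
            (DirectSum.decompose 𝒜 r (k • w₀ - j • w))) (pow_mem_smul 𝒜 hf j)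
          rwa [sub_add_cancel] at this
        -- Replacing `g` by `f ^ j` keeps the weight and strictly raises the value.
        refine lt_of_lt_of_le ?_ (hmax k _ h₂)
        refine pow_lt_pow_left₀ ?_ zero_le hm.ne'
        rw [map_mul, map_mul, map_pow]
        exact mul_lt_mul_of_pos_left (hV j g hg hgx) (zero_lt_iff.2 hr0)
  have hrad : h ∉ J.radical := by
    rintro ⟨N, hN⟩
    have h₁ := hJ _ hN (N * m)
    have h₂ := pow_mem_smul 𝒜 hh N
    rw [smul_smul] at h₂
    rw [GradedRing.proj_apply, DirectSum.decompose_of_mem_same 𝒜 h₂, map_pow, ← pow_mul] at h₁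
    exact lt_irrefl _ h₁
  rw [Ideal.radical_eq_jacobson, Ideal.jacobson, Submodule.mem_sInf] at hrad
  push Not at hrad
  obtain ⟨y, ⟨hJy, hy⟩, hhy⟩ := hrad
  exact ⟨⟨y, hy⟩, ⟨m, hm, h, hh, hhy⟩, fun k g hg hgx => hJy (Ideal.subset_span ⟨hgx, k, hg⟩)⟩

end Valuations

/-! ### Orbit cones: finiteness, faces and sums -/

section OrbitConesOfFamily

variable {K R M : Type*} [Field K] [CommRing R] [Algebra K R] [AddCommGroup M]
  (𝒜 : M → Submodule K R)

/-- The collection of all orbit cones. -/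
def orbitCones : Set (PointedCone ℚ (ℚ ⊗[ℤ] M)) := Set.range (orbitCone 𝒜)

lemma gitCone_eq_chamber (w : M) : gitCone 𝒜 w = chamber (orbitCones 𝒜) (toRat w) := by
  refine congrArg sInf (Set.ext fun ω => ?_)
  constructor
  · rintro ⟨x, rfl, h⟩
    exact ⟨⟨x, rfl⟩, h⟩
  · rintro ⟨⟨x, rfl⟩, h⟩
    exact ⟨x, rfl, h⟩

end OrbitConesOfFamily

section OrbitCones

variable {K R M : Type*} [Field K] [CommRing R] [Algebra K R] [AddCommGroup M]
  [DecidableEq M] (𝒜 : M → Submodule K R) [GradedAlgebra 𝒜]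

/-- The orbit monoid of a point as a submonoid of the lattice. -/
def orbitSubmonoid (x : MaximalSpectrum R) : AddSubmonoid M where
  carrier := orbitMonoid 𝒜 x
  zero_mem' := ⟨1, SetLike.one_mem_graded 𝒜, x.isMaximal.isPrime.one_notMem⟩
  add_mem' := by
    rintro u v ⟨f, hf, hfx⟩ ⟨g, hg, hgx⟩
    exact ⟨f * g, SetLike.mul_mem_graded hf hg,
      fun h => (x.isMaximal.isPrime.mem_or_mem h).elim hfx hgx⟩

lemma mem_orbitSubmonoid {x : MaximalSpectrum R} {w : M} :
    w ∈ orbitSubmonoid 𝒜 x ↔ ∃ f ∈ 𝒜 w, f ∉ x.asIdeal := Iff.rfl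

lemma orbitCone_eq (x : MaximalSpectrum R) :
    orbitCone 𝒜 x = monoidCone (orbitSubmonoid 𝒜 x) := rfl

lemma mem_orbitCone {x : MaximalSpectrum R} {v : ℚ ⊗[ℤ] M} :
    v ∈ orbitCone 𝒜 x ↔ ∃ n : ℕ, 0 < n ∧ ∃ w ∈ orbitSubmonoid 𝒜 x, (n : ℚ) • v = toRat w := by
  rw [orbitCone_eq, mem_monoidCone]

/-- The weights of an integral graded algebra as a submonoid of the lattice. -/
def weightSubmonoid [IsDomain R] : AddSubmonoid M where
  carrier := {w | 𝒜 w ≠ ⊥}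
  zero_mem' := (Submodule.ne_bot_iff _).2 ⟨1, SetLike.one_mem_graded 𝒜, one_ne_zero⟩
  add_mem' := by
    intro u v hu hv
    obtain ⟨f, hf, hf0⟩ := (Submodule.ne_bot_iff _).1 hu
    obtain ⟨g, hg, hg0⟩ := (Submodule.ne_bot_iff _).1 hv
    exact (Submodule.ne_bot_iff _).2 ⟨f * g, SetLike.mul_mem_graded hf hg, mul_ne_zero hf0 hg0⟩

lemma weightCone_eq [IsDomain R] : weightCone 𝒜 = monoidCone (weightSubmonoid 𝒜) := rfl

lemma mem_weightCone [IsDomain R] {v : ℚ ⊗[ℤ] M} :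
    v ∈ weightCone 𝒜 ↔ ∃ n : ℕ, 0 < n ∧ ∃ w ∈ weightSubmonoid 𝒜, (n : ℚ) • v = toRat w := by
  rw [weightCone_eq, mem_monoidCone]

lemma orbitSubmonoid_le [IsDomain R] (x : MaximalSpectrum R) :
    orbitSubmonoid 𝒜 x ≤ weightSubmonoid 𝒜 := by
  rintro w ⟨f, hf, hfx⟩
  exact (Submodule.ne_bot_iff _).2 ⟨f, hf, fun h => hfx (h ▸ x.asIdeal.zero_mem)⟩

lemma exists_mem_orbitSubmonoid [IsDomain R] [Algebra.FiniteType K R] {w : M}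
    (hw : w ∈ weightSubmonoid 𝒜) : ∃ x : MaximalSpectrum R, w ∈ orbitSubmonoid 𝒜 x := by
  have : IsJacobsonRing R := isJacobsonRing_of_finiteType (A := K)
  obtain ⟨f, hf, hf0⟩ := (Submodule.ne_bot_iff _).1 hw
  have h : f ∉ (⊥ : Ideal R).jacobson := by
    rwa [IsJacobsonRing.out ‹_› (Ideal.isPrime_bot (α := R)).isRadical, Ideal.mem_bot]
  rw [Ideal.jacobson, Submodule.mem_sInf] at h
  push Not at h
  obtain ⟨x, ⟨-, hx⟩, hfx⟩ := h
  exact ⟨⟨x, hx⟩, f, hf, hfx⟩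

lemma support_orbitCones [IsDomain R] [Algebra.FiniteType K R] :
    support (orbitCones 𝒜) = (weightCone 𝒜 : Set (ℚ ⊗[ℤ] M)) := by
  ext v
  simp only [support, orbitCones, Set.mem_iUnion, Set.mem_range, SetLike.mem_coe, exists_prop,
    exists_exists_eq_and]
  constructor
  · rintro ⟨x, hx⟩
    obtain ⟨n, hn, w, hw, e⟩ := (mem_orbitCone 𝒜).1 hx
    exact (mem_weightCone 𝒜).2 ⟨n, hn, w, orbitSubmonoid_le 𝒜 x hw, e⟩
  · intro hv
    obtain ⟨n, hn, w, hw, e⟩ := (mem_weightCone 𝒜).1 hv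
    obtain ⟨x, hx⟩ := exists_mem_orbitSubmonoid 𝒜 hw
    exact ⟨x, (mem_orbitCone 𝒜).2 ⟨n, hn, w, hx, e⟩⟩

/-- Every rational vector has a positive multiple in the lattice, and chambers do not change under
positive scaling. -/
lemma gitCones_eq [IsDomain R] [Algebra.FiniteType K R] :
    gitCones 𝒜 = chamber (orbitCones 𝒜) '' support (orbitCones 𝒜) := by
  rw [support_orbitCones]
  ext σ
  constructor
  · rintro ⟨w, hw, rfl⟩
    exact ⟨_, hw, (gitCone_eq_chamber 𝒜 w).symm⟩
  · rintro ⟨v, hv, rfl⟩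
    obtain ⟨n, hn, w, e⟩ := exists_smul_eq_toRat v
    have hn' : (0 : ℚ) < n := Nat.cast_pos.2 hn
    refine ⟨w, ?_, ?_⟩
    · rw [← e]
      exact PointedCone.smul_mem _ hn'.le hv
    · rw [gitCone_eq_chamber, ← e, chamber_smul _ hn']

/-- A finitely generated graded algebra has a finite set of homogeneous generators. -/
lemma exists_homogeneous_generators [Algebra.FiniteType K R] :
    ∃ s : Finset R, Algebra.adjoin K (s : Set R) = ⊤ ∧ ∀ g ∈ s, ∃ u, g ∈ 𝒜 u := by
  classical
  obtain ⟨F, hF⟩ := Algebra.FiniteType.out (R := K) (A := R)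
  refine ⟨F.biUnion fun f => (DirectSum.decompose 𝒜 f).support.image
    fun u => (DirectSum.decompose 𝒜 f u : R), ?_, ?_⟩
  · rw [← top_le_iff, ← hF, Algebra.adjoin_le_iff]
    intro f hf
    rw [← DirectSum.sum_support_decompose 𝒜 f]
    exact sum_mem fun u hu => Algebra.subset_adjoin
      (Finset.mem_biUnion.2 ⟨f, hf, Finset.mem_image.2 ⟨u, hu, rfl⟩⟩)
  · intro g hg
    obtain ⟨f, -, hg⟩ := Finset.mem_biUnion.1 hg
    obtain ⟨u, -, rfl⟩ := Finset.mem_image.1 hg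
    exact ⟨u, SetLike.coe_mem _⟩

/-- The orbit monoid of a point is generated by the degrees of the generators which do not vanish
at it. -/
lemma orbitSubmonoid_eq_closure {s : Set R} (hs : Algebra.adjoin K s = ⊤) {deg : R → M}
    (hdeg : ∀ g ∈ s, g ∈ 𝒜 (deg g)) (x : MaximalSpectrum R) :
    orbitSubmonoid 𝒜 x = AddSubmonoid.closure (deg '' {g ∈ s | g ∉ x.asIdeal}) := by
  classical
  set N := AddSubmonoid.closure (deg '' {g ∈ s | g ∉ x.asIdeal}) with hN
  refine le_antisymm ?_ (AddSubmonoid.closure_le.2 ?_)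
  -- The claim passes to products: if `i + j` is outside `N`, so is `i` or `j`.
  · have key : ∀ r : R, ∀ u ∉ N, GradedRing.proj 𝒜 u r ∈ x.asIdeal := by
      intro r
      have hr : r ∈ Algebra.adjoin K s := hs ▸ Algebra.mem_top
      induction hr using Algebra.adjoin_induction with
      | mem g hg =>
        intro u hu
        rw [GradedRing.proj_apply]
        by_cases h : deg g = u
        · subst h
          rw [DirectSum.decompose_of_mem_same 𝒜 (hdeg g hg)]
          by_contra hgx
          exact hu (AddSubmonoid.subset_closure ⟨g, ⟨hg, hgx⟩, rfl⟩)
        · rw [DirectSum.decompose_of_mem_ne 𝒜 (hdeg g hg) h]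
          exact x.asIdeal.zero_mem
      | algebraMap c =>
        intro u hu
        rw [GradedRing.proj_apply, DirectSum.decompose_of_mem_ne 𝒜
          (SetLike.algebraMap_mem_graded 𝒜 c) (fun h : 0 = u => hu (h ▸ N.zero_mem))]
        exact x.asIdeal.zero_mem
      | add a b _ _ ha hb =>
        intro u hu
        rw [map_add]
        exact x.asIdeal.add_mem (ha u hu) (hb u hu)
      | mul a b _ _ ha hb =>
        intro u hu
        rw [GradedRing.proj_apply, DirectSum.decompose_mul, DirectSum.coe_mul_apply]
        refine x.asIdeal.sum_mem fun ij hij => ?_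
        have hij := (Finset.mem_filter.1 hij).2
        by_cases hi : ij.1 ∈ N
        · exact x.asIdeal.mul_mem_left _ (hb _ fun hj => hu (hij ▸ N.add_mem hi hj))
        · exact x.asIdeal.mul_mem_right _ (ha _ hi)
    rintro u ⟨f, hf, hfx⟩
    by_contra hu
    have h := key f u hu
    rw [GradedRing.proj_apply, DirectSum.decompose_of_mem_same 𝒜 hf] at h
    exact hfx h
  · rintro _ ⟨g, ⟨hg, hgx⟩, rfl⟩
    exact ⟨g, hdeg g hg, hgx⟩

lemma finite_range_orbitSubmonoid [Algebra.FiniteType K R] :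
    (Set.range (orbitSubmonoid 𝒜)).Finite ∧ ∀ x, (orbitSubmonoid 𝒜 x).FG := by
  obtain ⟨s, hs, h⟩ := exists_homogeneous_generators 𝒜
  choose! deg hdeg using h
  have key := orbitSubmonoid_eq_closure 𝒜 hs hdeg
  constructor
  · refine (s.finite_toSet.finite_subsets.image fun t => AddSubmonoid.closure (deg '' t)).subset ?_
    rintro _ ⟨x, rfl⟩
    exact ⟨_, fun g hg => hg.1, (key x).symm⟩
  · intro x
    rw [key x]
    exact (AddSubmonoid.fg_iff _).2 ⟨_, rfl,
      (s.finite_toSet.subset fun g hg => hg.1).image _⟩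

lemma orbitCones_eq_image : orbitCones 𝒜 = monoidCone '' Set.range (orbitSubmonoid 𝒜) := by
  rw [← Set.range_comp]
  rfl

lemma finite_orbitCones [Algebra.FiniteType K R] : (orbitCones 𝒜).Finite := by
  rw [orbitCones_eq_image]
  exact (finite_range_orbitSubmonoid 𝒜).1.image _

lemma chamber_orbitCones_fg [Module.Free ℤ M] [Module.Finite ℤ M] [Algebra.FiniteType K R]
    (v : ℚ ⊗[ℤ] M) : (chamber (orbitCones 𝒜) v).FG := by
  have h : {ω | ω ∈ orbitCones 𝒜 ∧ v ∈ ω} =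
      monoidCone '' {S ∈ Set.range (orbitSubmonoid 𝒜) | v ∈ monoidCone S} := by
    rw [orbitCones_eq_image]
    ext ω
    constructor
    · rintro ⟨⟨S, hS, rfl⟩, hv⟩
      exact ⟨S, ⟨hS, hv⟩, rfl⟩
    · rintro ⟨S, ⟨hS, hv⟩, rfl⟩
      exact ⟨⟨S, hS, rfl⟩, hv⟩
  rw [chamber, h]
  refine sInf_monoidCone_fg ((finite_range_orbitSubmonoid 𝒜).1.subset fun S hS => hS.1) ?_
  rintro _ ⟨⟨x, rfl⟩, -⟩
  exact (finite_range_orbitSubmonoid 𝒜).2 x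

/-- The truncation of an element to the components with degrees in a given submonoid. -/
def truncate (F : AddSubmonoid M) [DecidablePred (· ∈ F)] : R →ₗ[K] R :=
  (DirectSum.toModule K M R fun u => if u ∈ F then (𝒜 u).subtype else 0) ∘ₗ
    (DirectSum.decomposeLinearEquiv 𝒜).toLinearMap

variable {𝒜} in
lemma truncate_of_mem {F : AddSubmonoid M} [DecidablePred (· ∈ F)] {u : M} {f : R} (hf : f ∈ 𝒜 u) :
    truncate 𝒜 F f = if u ∈ F then f else 0 := by
  lift f to 𝒜 u using hf
  simp only [truncate, LinearMap.comp_apply, LinearEquiv.coe_coe,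
    DirectSum.decomposeLinearEquiv_apply, DirectSum.decompose_coe]
  rw [← DirectSum.lof_eq_of K, DirectSum.toModule_lof]
  split_ifs <;> rfl

/-- Truncation to the degrees in a face of the orbit monoid of a point is multiplicative modulo
the ideal of the point. -/
lemma truncate_mul_sub_mem {x : MaximalSpectrum R} {F : AddSubmonoid M} [DecidablePred (· ∈ F)]
    (hF : ∀ u ∈ orbitSubmonoid 𝒜 x, ∀ v ∈ orbitSubmonoid 𝒜 x, u + v ∈ F → u ∈ F) (a b : R) :
    truncate 𝒜 F (a * b) - truncate 𝒜 F a * truncate 𝒜 F b ∈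
      x.asIdeal := by
  induction a using DirectSum.Decomposition.inductionOn 𝒜 with
  | zero => simp
  | add a a' ha ha' =>
    have h := x.asIdeal.add_mem ha ha'
    rw [add_mul, map_add, map_add]
    convert h using 1
    ring
  | @homogeneous u a =>
    induction b using DirectSum.Decomposition.inductionOn 𝒜 with
    | zero => simp
    | add b b' hb hb' =>
      have h := x.asIdeal.add_mem hb hb'
      rw [mul_add, map_add, map_add]
      convert h using 1
      ring
    | @homogeneous v b =>
      rw [truncate_of_mem (SetLike.mul_mem_graded a.2 b.2), truncate_of_mem a.2,
        truncate_of_mem b.2]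
      by_cases hu : u ∈ F <;> by_cases hv : v ∈ F
      · simp [hu, hv, F.add_mem hu hv]
      all_goals
        simp only [hu, hv, if_true, if_false, mul_zero, zero_mul, sub_zero]
        split_ifs with huv
        · by_contra hab
          have ha : u ∈ orbitSubmonoid 𝒜 x := ⟨a, a.2, fun h => hab (x.asIdeal.mul_mem_right _ h)⟩
          have hb : v ∈ orbitSubmonoid 𝒜 x := ⟨b, b.2, fun h => hab (x.asIdeal.mul_mem_left _ h)⟩
          have h₁ := hF u ha v hb huv
          have h₂ := hF v hb u ha (by rwa [add_comm])
          tauto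
        · exact x.asIdeal.zero_mem

/-- By the Nullstellensatz the residue field at a closed point is finite over `K`, hence equal to
it. -/
lemma exists_sub_algebraMap_mem [IsAlgClosed K] [Algebra.FiniteType K R] (x : MaximalSpectrum R)
    (f : R) : ∃ c : K, f - algebraMap K R c ∈ x.asIdeal := by
  have := x.isMaximal
  let : Field (R ⧸ x.asIdeal) := Ideal.Quotient.field _
  have : Module.Finite K (R ⧸ x.asIdeal) := finite_of_finite_type_of_isJacobsonRing _ _
  obtain ⟨c, hc⟩ := (IsAlgClosed.algebraMap_bijective_of_isIntegral
    (k := K) (K := R ⧸ x.asIdeal)).2 (Ideal.Quotient.mk _ f)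
  exact ⟨c, Ideal.Quotient.eq.1 hc.symm⟩

/-- Every face of the orbit monoid of a point `x` contains the orbit monoid of a point `y`, which
can be chosen such that a given weight of the face belongs to it. -/
lemma exists_point_of_face [IsAlgClosed K] [Algebra.FiniteType K R] (x : MaximalSpectrum R)
    {F : AddSubmonoid M} (hFx : F ≤ orbitSubmonoid 𝒜 x)
    (hF : ∀ u ∈ orbitSubmonoid 𝒜 x, ∀ v ∈ orbitSubmonoid 𝒜 x, u + v ∈ F → u ∈ F)
    {w : M} (hw : w ∈ F) :
    ∃ y : MaximalSpectrum R, w ∈ orbitSubmonoid 𝒜 y ∧ orbitSubmonoid 𝒜 y ≤ F := by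
  classical
  have h1 : truncate 𝒜 F (1 : R) = 1 := by
    rw [truncate_of_mem (SetLike.one_mem_graded 𝒜), if_pos F.zero_mem]
  -- Truncation followed by evaluation at `x` is multiplicative, so its kernel is an ideal; a
  -- maximal ideal above it is the required point.
  let I : Ideal R :=
    { carrier := {r | truncate 𝒜 F r ∈ x.asIdeal}
      zero_mem' := by simp
      add_mem' := fun {a b} ha hb => by
        rw [Set.mem_ofPred_eq, map_add]
        exact x.asIdeal.add_mem ha hb
      smul_mem' := fun a b hb => by
        have h := x.asIdeal.add_mem (truncate_mul_sub_mem 𝒜 hF a b)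
          (x.asIdeal.mul_mem_left (truncate 𝒜 F a) hb)
        rwa [sub_add_cancel] at h }
  have hI : I ≠ ⊤ := by
    rw [Ideal.ne_top_iff_one]
    intro h
    exact x.isMaximal.isPrime.one_notMem (h1 ▸ h : (1 : R) ∈ x.asIdeal)
  obtain ⟨y, hy, hIy⟩ := Ideal.exists_le_maximal I hI
  refine ⟨⟨y, hy⟩, ?_, ?_⟩
  · obtain ⟨f, hf, hfx⟩ := hFx hw
    refine ⟨f, hf, fun hfy => ?_⟩
    obtain ⟨c, hc⟩ := exists_sub_algebraMap_mem (K := K) x f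
    have hc0 : c ≠ 0 := by
      rintro rfl
      rw [map_zero, sub_zero] at hc
      exact hfx hc
    -- Both weights `w` and `0` lie in `F`, so truncation fixes this element. Thus `f` takes at `y`
    -- the same nonzero value `c` as at `x`.
    have h : f - algebraMap K R c ∈ I := by
      change truncate 𝒜 F (f - algebraMap K R c) ∈ x.asIdeal
      rwa [map_sub, truncate_of_mem hf, if_pos hw,
        truncate_of_mem (SetLike.algebraMap_mem_graded 𝒜 c), if_pos F.zero_mem]
    have hcy : algebraMap K R c ∈ y := by
      have := y.sub_mem hfy (hIy h)
      rwa [sub_sub_cancel] at this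
    exact hy.ne_top (Ideal.eq_top_of_isUnit_mem _ hcy ((IsUnit.mk0 c hc0).map _))
  · rintro u ⟨f, hf, hfy⟩
    by_contra hu
    refine hfy (hIy ?_)
    change truncate 𝒜 F f ∈ x.asIdeal
    rw [truncate_of_mem hf, if_neg hu]
    exact x.asIdeal.zero_mem

/-- The elements of the orbit monoid dividing a multiple of `w` form its smallest face containing
`w`; a point belonging to that face does the job. -/
lemma exists_point_of_minimal_face [IsAlgClosed K] [Algebra.FiniteType K R]
    (x : MaximalSpectrum R) {w : M} (hw : w ∈ orbitSubmonoid 𝒜 x) :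
    ∃ y : MaximalSpectrum R, w ∈ orbitSubmonoid 𝒜 y ∧
      ∀ t ∈ orbitSubmonoid 𝒜 y, ∃ t' ∈ orbitSubmonoid 𝒜 x, ∃ k : ℕ, t + t' = k • w := by
  set S := orbitSubmonoid 𝒜 x
  let F : AddSubmonoid M :=
    { carrier := {t | t ∈ S ∧ ∃ t' ∈ S, ∃ k : ℕ, t + t' = k • w}
      zero_mem' := ⟨S.zero_mem, 0, S.zero_mem, 0, by simp⟩
      add_mem' := by
        rintro a b ⟨ha, a', ha', k, e⟩ ⟨hb, b', hb', l, e'⟩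
        refine ⟨S.add_mem ha hb, a' + b', S.add_mem ha' hb', k + l, ?_⟩
        rw [add_smul, ← e, ← e']; abel }
  obtain ⟨y, hy, hyF⟩ := exists_point_of_face 𝒜 x (F := F) (fun t ht => ht.1)
    (by
      rintro u hu v hv ⟨-, t, ht, k, e⟩
      exact ⟨hu, v + t, S.add_mem hv ht, k, by rw [← e, add_assoc]⟩)
    (w := w) ⟨hw, 0, S.zero_mem, 1, by simp⟩
  exact ⟨y, hy, fun t ht => (hyF ht).2⟩

lemma exists_smul_sub_mem_orbitCone [IsAlgClosed K] [Algebra.FiniteType K R] :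
    ∀ ω ∈ orbitCones 𝒜, ∀ v ∈ ω, ∀ u ∈ chamber (orbitCones 𝒜) v, ∃ c : ℚ, c • v - u ∈ ω := by
  rintro _ ⟨x, rfl⟩ v hv u hu
  obtain ⟨n, hn, w, hw, e⟩ := (mem_orbitCone 𝒜).1 hv
  obtain ⟨y, hy, hyx⟩ := exists_point_of_minimal_face 𝒜 x hw
  obtain ⟨m, hm, t, ht, e'⟩ :=
    (mem_orbitCone 𝒜).1 (mem_chamber.1 hu _ ⟨y, rfl⟩ ((mem_orbitCone 𝒜).2 ⟨n, hn, w, hy, e⟩))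
  obtain ⟨t', ht', k, ek⟩ := hyx t ht
  have hm' : (m : ℚ) ≠ 0 := Nat.cast_ne_zero.2 hm.ne'
  -- From `n v = w`, `m u = t` and `t + t' = k w`: the `m`-fold of the difference is `t'`.
  refine ⟨k * n / m, (mem_orbitCone 𝒜).2 ⟨m, hm, t', ht', ?_⟩⟩
  have h : toRat t + toRat t' = (k : ℚ) • toRat w := by rw [← toRat_add, ek, toRat_nsmul]
  rw [smul_sub, smul_smul, mul_div_cancel₀ _ hm', e', mul_smul, e, ← h, add_sub_cancel_left]

/-- Specialize `x` to a point `y` whose orbit cone contains `v₀`, hence `u` and `u'`. A product of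
sections for `u` and `u'` is nonzero at `y` and has weight a multiple of `u + u'`, so it is nonzero
at `x`, and so are its factors. -/
lemma mem_chamber_add [Module.Free ℤ M] [IsDomain R] [Algebra.FiniteType K R] :
    ∀ v₀ ∈ support (orbitCones 𝒜), ∀ u ∈ chamber (orbitCones 𝒜) v₀,
      ∀ u' ∈ chamber (orbitCones 𝒜) v₀, u ∈ chamber (orbitCones 𝒜) (u + u') := by
  intro v₀ hv₀ u hu u' hu'
  rw [support_orbitCones] at hv₀
  obtain ⟨n₀, hn₀, w₀, hw₀, e₀⟩ := (mem_weightCone 𝒜).1 hv₀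
  rw [mem_chamber]
  rintro _ ⟨x, rfl⟩ hx
  obtain ⟨n, hn, w, hw, e⟩ := (mem_orbitCone 𝒜).1 hx
  obtain ⟨y, ⟨m, hm, hmy⟩, hy⟩ := exists_specializing_point 𝒜 x hw hw₀
  have hv₀y : v₀ ∈ orbitCone 𝒜 y := (mem_orbitCone 𝒜).2
    ⟨m * n₀, Nat.mul_pos hm hn₀, m • w₀, hmy, by rw [Nat.cast_mul, mul_smul, e₀, toRat_nsmul]⟩
  obtain ⟨a, ha, p, ⟨f, hf, hfy⟩, ep⟩ := (mem_orbitCone 𝒜).1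
    (mem_chamber.1 hu _ ⟨y, rfl⟩ hv₀y)
  obtain ⟨b, hb, q, ⟨g, hg, hgy⟩, eq⟩ := (mem_orbitCone 𝒜).1
    (mem_chamber.1 hu' _ ⟨y, rfl⟩ hv₀y)
  -- The exponents balance `p = a u`, `q = b u'` and `w = n (u + u')`.
  have hpq : (b * n) • p + (a * n) • q = (a * b) • w := by
    apply toRat_injective
    simp only [toRat_add, toRat_nsmul, ← e, ← ep, ← eq, smul_add, smul_smul, Nat.cast_mul]
    congr 2 <;> ring
  have hfg : f ^ (b * n) * g ^ (a * n) ∈ 𝒜 ((a * b) • w) := by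
    rw [← hpq]
    exact SetLike.mul_mem_graded (pow_mem_smul 𝒜 hf _) (pow_mem_smul 𝒜 hg _)
  have hy' := y.isMaximal.isPrime
  refine (mem_orbitCone 𝒜).2 ⟨a, ha, p, ⟨f, hf, fun hfx => ?_⟩, ep⟩
  rcases hy'.mem_or_mem (hy _ _ hfg (x.asIdeal.mul_mem_right _
    (x.asIdeal.pow_mem_of_mem hfx _ (Nat.mul_pos hb hn)))) with h | h
  · exact hfy (hy'.mem_of_pow_mem _ h)
  · exact hgy (hy'.mem_of_pow_mem _ h)

end OrbitCones

/-! ### Linearizations are characters -/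

section Linearizations

/-- In a graded domain, every factor of a nonzero homogeneous element is homogeneous. -/
lemma exists_mem_of_mul_mem {K A M : Type*} [Field K] [CommRing A] [IsDomain A] [Algebra K A]
    [AddCommGroup M] [DecidableEq M] [TwoUniqueSums M] (ℬ : M → Submodule K A) [GradedAlgebra ℬ]
    {a b : A} {v : M} (hab : a * b ∈ ℬ v) (hab0 : a * b ≠ 0) : ∃ u, b ∈ ℬ u := by
  classical
  set α := (DirectSum.decompose ℬ a).support with hα
  set β := (DirectSum.decompose ℬ b).support with hβ
  have hne : ∀ {c : A}, c ≠ 0 → (DirectSum.decompose ℬ c).support.Nonempty := by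
    intro c hc
    rw [Finset.nonempty_iff_ne_empty, Ne, DFinsupp.support_eq_empty]
    exact fun h => hc
      ((DirectSum.decompose ℬ).injective (h.trans (DirectSum.decompose_zero ℬ).symm))
  have hα1 : α.Nonempty := hne (left_ne_zero_of_mul hab0)
  have hβ1 : β.Nonempty := hne (right_ne_zero_of_mul hab0)
  -- A uniquely attained sum of degrees cannot cancel in a domain, so it is the degree of the
  -- product.
  have hdeg : ∀ i ∈ α, ∀ j ∈ β, UniqueAdd α β i j → i + j = v := by
    intro i hi j hj hu
    by_contra hne
    have h₁ : (DirectSum.decompose ℬ (a * b) (i + j) : A) = 0 :=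
      DirectSum.decompose_of_mem_ne ℬ hab (Ne.symm hne)
    rw [DirectSum.decompose_mul, DirectSum.coe_mul_apply, Finset.sum_eq_single (i, j)] at h₁
    · rcases mul_eq_zero.1 h₁ with h | h
      · exact DFinsupp.mem_support_iff.1 hi (Subtype.ext h)
      · exact DFinsupp.mem_support_iff.1 hj (Subtype.ext h)
    · rintro ⟨i', j'⟩ h hij
      obtain ⟨h, hs⟩ := Finset.mem_filter.1 h
      obtain ⟨hi', hj'⟩ := Finset.mem_product.1 h
      obtain ⟨rfl, rfl⟩ := hu hi' hj' hs
      exact absurd rfl hij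
    · intro h
      exact (h (Finset.mem_filter.2 ⟨Finset.mem_product.2 ⟨hi, hj⟩, rfl⟩)).elim
  -- Otherwise two distinct pairs would have unique sums, both equal to `v`, contradicting
  -- uniqueness.
  have hcard : α.card * β.card ≤ 1 := by
    by_contra! h
    obtain ⟨p, hp, q, hq, hpq, hup, huq⟩ := TwoUniqueSums.uniqueAdd_of_one_lt_card h
    obtain ⟨hp₁, hp₂⟩ := Finset.mem_product.1 hp
    obtain ⟨hq₁, hq₂⟩ := Finset.mem_product.1 hq
    have h := huq hp₁ hp₂ ((hdeg _ hp₁ _ hp₂ hup).trans (hdeg _ hq₁ _ hq₂ huq).symm)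
    exact hpq (Prod.ext h.1 h.2)
  have hβc : β.card = 1 := by
    have h₁ := hα1.card_pos
    have h₂ := hβ1.card_pos
    nlinarith
  obtain ⟨u, hu⟩ := Finset.card_eq_one.1 hβc
  refine ⟨u, ?_⟩
  have h := DirectSum.sum_support_decompose ℬ b
  rw [← hβ, hu, Finset.sum_singleton] at h
  exact h ▸ SetLike.coe_mem _

/-- Two decompositions of a module with componentwise inclusions coincide. -/
lemma eq_of_decomposition_le {K A M : Type*} [Field K] [AddCommGroup A] [Module K A]
    [DecidableEq M] (ℬ 𝒞 : M → Submodule K A) [DirectSum.Decomposition ℬ]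
    [DirectSum.Decomposition 𝒞] (h : ∀ v, ℬ v ≤ 𝒞 v) : ℬ = 𝒞 := by
  have key : ∀ (p : A) (v : M),
      (DirectSum.decompose 𝒞 p v : A) = (DirectSum.decompose ℬ p v : A) := by
    intro p v
    induction p using DirectSum.Decomposition.inductionOn ℬ with
    | zero => simp
    | add p q hp hq => simp [hp, hq]
    | @homogeneous u p =>
      by_cases huv : u = v
      · subst huv
        rw [DirectSum.decompose_of_mem_same 𝒞 (h u p.2), DirectSum.decompose_of_mem_same ℬ p.2]
      · rw [DirectSum.decompose_of_mem_ne 𝒞 (h u p.2) huv,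
          DirectSum.decompose_of_mem_ne ℬ p.2 huv]
  funext v
  refine le_antisymm (h v) fun p hp => ?_
  rw [← DirectSum.decompose_of_mem_same 𝒞 hp, key]
  exact SetLike.coe_mem _

namespace TrivialLinearization

variable {K R M : Type*} [Field K] [CommRing R] [Algebra K R] [AddCommGroup M]
  [DecidableEq M] {𝒜 : M → Submodule K R}

/-- The algebra `R[z]` with the grading given by a linearization. -/
@[reducible] def gradedAlgebra (L : TrivialLinearization 𝒜) : GradedAlgebra L.piece where
  toGradedMonoid := L.gradedMonoid
  toDecomposition := L.isInternal.chooseDecomposition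

/-- Projection to degree one in `z` commutes with the weight decomposition, so a nonzero component
of `z` is some `b z`, and its factor `z` is homogeneous. -/
lemma exists_X_mem_piece [IsDomain R] [TwoUniqueSums M] (L : TrivialLinearization 𝒜) :
    ∃ u, (Polynomial.X : Polynomial R) ∈ L.piece u := by
  have := L.gradedAlgebra
  have hcoeff : ∀ (p : Polynomial R) (v : M),
      (DirectSum.decompose L.piece (Polynomial.monomial 1 (p.coeff 1)) v : Polynomial R) =
        Polynomial.monomial 1 ((DirectSum.decompose L.piece p v : Polynomial R).coeff 1) := by
    intro p v
    induction p using DirectSum.Decomposition.inductionOn L.piece with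
    | zero => simp
    | add p q hp hq => simp [hp, hq]
    | @homogeneous u p =>
      by_cases huv : u = v
      · subst huv
        rw [DirectSum.decompose_of_mem_same _ (L.commutes _ _ p.2 1),
          DirectSum.decompose_of_mem_same _ p.2]
      · rw [DirectSum.decompose_of_mem_ne _ (L.commutes _ _ p.2 1) huv,
          DirectSum.decompose_of_mem_ne _ p.2 huv]
        simp
  obtain ⟨v, hv⟩ : ∃ v, (DirectSum.decompose L.piece (Polynomial.X : Polynomial R) v :
      Polynomial R) ≠ 0 := by
    by_contra! H
    refine Polynomial.X_ne_zero (R := R) ?_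
    rw [← (DirectSum.decompose L.piece).injective.eq_iff, DirectSum.decompose_zero]
    exact DFinsupp.ext fun v => Subtype.ext (H v)
  have h := hcoeff Polynomial.X v
  rw [Polynomial.coeff_X_one, ← Polynomial.X_pow_eq_monomial, pow_one,
    ← Polynomial.C_mul_X_eq_monomial] at h
  have hmem := SetLike.coe_mem (DirectSum.decompose L.piece (Polynomial.X : Polynomial R) v)
  rw [h] at hmem hv
  exact exists_mem_of_mul_mem L.piece hmem hv

/-- Every linearization of the trivial bundle is given by a unique character. -/
theorem existsUnique_eq_ofCharacter [IsDomain R] [TwoUniqueSums M] [GradedAlgebra 𝒜]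
    (L : TrivialLinearization 𝒜) : ∃! w : M, L = ofCharacter 𝒜 w := by
  obtain ⟨u, hu⟩ := L.exists_X_mem_piece
  have hgr := L.gradedAlgebra
  have hL : L = ofCharacter 𝒜 (-u) := by
    have := (ofCharacter 𝒜 (-u)).gradedAlgebra
    refine TrivialLinearization.ext
      (eq_of_decomposition_le (ofCharacter 𝒜 (-u)).piece L.piece fun v p hp => ?_).symm
    -- Coefficients are homogeneous by equivariance and `z` has weight `u`, so each term has weight
    -- `v`.
    rw [p.as_sum_support_C_mul_X_pow]
    refine sum_mem fun n _ => ?_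
    have h := SetLike.mul_mem_graded (L.equivariant _ _ (hp n)) (SetLike.pow_mem_graded n hu)
    rwa [smul_neg, neg_add_cancel_right] at h
  refine ⟨-u, hL, fun w hw => ?_⟩
  have h₁ : (1 : R) ∈ 𝒜 (u + 1 • w) := by
    have := hu
    rw [hw, ← pow_one Polynomial.X, Polynomial.X_pow_eq_monomial] at this
    exact monomial_mem_charPiece.1 this
  have h₂ := DirectSum.degree_eq_of_mem_mem 𝒜 h₁ (SetLike.one_mem_graded 𝒜) one_ne_zero
  rw [one_smul] at h₂
  exact (neg_eq_of_add_eq_zero_right h₂).symm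

end TrivialLinearization

end Linearizations

/-! ### Semistable points through orbit cones -/

section Semistability

variable {K R M : Type*} [Field K] [CommRing R] [Algebra K R] [AddCommGroup M]
  [DecidableEq M] (𝒜 : M → Submodule K R) [GradedAlgebra 𝒜]

lemma twoUniqueSums_of_free (M : Type*) [AddCommGroup M] [Module.Free ℤ M] : TwoUniqueSums M :=
  TwoUniqueSums.of_injective_addHom (toRatHom M).toAddHom toRat_injective inferInstance

lemma mem_semistableSet [Module.Free ℤ M] {w : M} {x : MaximalSpectrum R} :
    x ∈ semistableSet 𝒜 w ↔ toRat w ∈ orbitCone 𝒜 x := by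
  rw [orbitCone_eq, toRat_mem_monoidCone]
  change (∃ n : ℕ, 0 < n ∧ ∃ f : R,
    Polynomial.monomial n f ∈ TrivialLinearization.charPiece 𝒜 w 0 ∧ f ∉ x.asIdeal) ↔ _
  simp only [TrivialLinearization.monomial_mem_charPiece, zero_add, mem_orbitSubmonoid]

lemma semistableSet_nonempty_iff [Module.Free ℤ M] [IsDomain R] [Algebra.FiniteType K R] {w : M} :
    (semistableSet 𝒜 w).Nonempty ↔ toRat w ∈ weightCone 𝒜 := by
  rw [← SetLike.mem_coe, ← support_orbitCones]
  simp only [Set.Nonempty, mem_semistableSet, support, orbitCones, Set.mem_iUnion, Set.mem_range,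
    SetLike.mem_coe, exists_prop, exists_exists_eq_and]

/-- Either side says that every orbit cone containing `w₁` contains `w₂`. -/
lemma semistableSet_subset_iff [Module.Free ℤ M] {w₁ w₂ : M} :
    semistableSet 𝒜 w₁ ⊆ semistableSet 𝒜 w₂ ↔ gitCone 𝒜 w₂ ≤ gitCone 𝒜 w₁ := by
  rw [gitCone_eq_chamber, gitCone_eq_chamber]
  constructor
  · intro h
    refine chamber_le_of_mem (mem_chamber.2 ?_)
    rintro _ ⟨x, rfl⟩ hx
    exact (mem_semistableSet 𝒜).1 (h ((mem_semistableSet 𝒜).2 hx))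
  · intro h x hx
    exact (mem_semistableSet 𝒜).2
      (mem_chamber.1 (h (self_mem_chamber _)) _ ⟨x, rfl⟩ ((mem_semistableSet 𝒜).1 hx))

lemma semistableSet_eq_iff [Module.Free ℤ M] {w₁ w₂ : M} :
    semistableSet 𝒜 w₁ = semistableSet 𝒜 w₂ ↔ gitCone 𝒜 w₁ = gitCone 𝒜 w₂ := by
  rw [Set.Subset.antisymm_iff, semistableSet_subset_iff, semistableSet_subset_iff, le_antisymm_iff,
    and_comm]

end Semistability

end AffineGIT
end

/-! ### The main theorem -/

theorem theorem2p9
    {K R M : Type*} [Field K] [IsAlgClosed K]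
    [CommRing R] [IsDomain R] [Algebra K R] [Algebra.FiniteType K R]
    [AddCommGroup M] [Module.Free ℤ M] [Module.Finite ℤ M] [DecidableEq M]
    (𝒜 : M → Submodule K R) [GradedAlgebra 𝒜] :
    -- the GIT-cones form a quasifan with support the weight cone
    AffineGIT.IsQuasifan (AffineGIT.gitCones 𝒜) ∧
    AffineGIT.support (AffineGIT.gitCones 𝒜) = (AffineGIT.weightCone 𝒜 : Set _) ∧
    -- the linearizations of the trivial bundle are given by the characters
    (∀ L : AffineGIT.TrivialLinearization 𝒜,
      ∃! w : M, L = AffineGIT.TrivialLinearization.ofCharacter 𝒜 w) ∧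
    -- there are semistable points exactly for the characters in the weight cone
    (∀ w : M, (AffineGIT.semistableSet 𝒜 w).Nonempty ↔
      AffineGIT.toRat w ∈ AffineGIT.weightCone 𝒜) ∧
    -- the order reversing correspondence
    (∀ w₁ w₂ : M, AffineGIT.toRat w₁ ∈ AffineGIT.weightCone 𝒜 →
      AffineGIT.toRat w₂ ∈ AffineGIT.weightCone 𝒜 →
      (AffineGIT.semistableSet 𝒜 w₁ ⊆ AffineGIT.semistableSet 𝒜 w₂ ↔
        AffineGIT.gitCone 𝒜 w₂ ≤ AffineGIT.gitCone 𝒜 w₁) ∧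
      (AffineGIT.semistableSet 𝒜 w₁ = AffineGIT.semistableSet 𝒜 w₂ ↔
        AffineGIT.gitCone 𝒜 w₁ = AffineGIT.gitCone 𝒜 w₂)) ∧
    ∃ e : {U : Set (MaximalSpectrum R) // U.Nonempty ∧
          ∃ L : AffineGIT.TrivialLinearization 𝒜, L.semistable = U} ≃o
        (AffineGIT.gitCones 𝒜)ᵒᵈ,
      ∀ U, ∀ w : M, U.1 = AffineGIT.semistableSet 𝒜 w →
        (OrderDual.ofDual (e U)).1 = AffineGIT.gitCone 𝒜 w := by
  open AffineGIT in
  have := twoUniqueSums_of_free M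
  have hlin : ∀ L : TrivialLinearization 𝒜, ∃! w : M, L = TrivialLinearization.ofCharacter 𝒜 w :=
    fun L => L.existsUnique_eq_ofCharacter
  refine ⟨?_, ?_, hlin, fun w => semistableSet_nonempty_iff 𝒜,
    fun w₁ w₂ _ _ => ⟨semistableSet_subset_iff 𝒜, semistableSet_eq_iff 𝒜⟩, ?_⟩
  · rw [gitCones_eq]
    exact isQuasifan_chambers (finite_orbitCones 𝒜) (fun v _ => chamber_orbitCones_fg 𝒜 v)
      (exists_smul_sub_mem_orbitCone 𝒜) (mem_chamber_add 𝒜)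
  · rw [gitCones_eq, support_chambers, support_orbitCones]
  have hex : ∀ U : {U : Set (MaximalSpectrum R) // U.Nonempty ∧
      ∃ L : TrivialLinearization 𝒜, L.semistable = U}, ∃ w : M, U.1 = semistableSet 𝒜 w := by
    rintro ⟨_, -, L, rfl⟩
    obtain ⟨w, rfl, -⟩ := hlin L
    exact ⟨w, rfl⟩
  -- The choice of weight is harmless: equal semistable sets have equal GIT-cones.
  choose wt hwt using hex
  have hΩ : ∀ U, toRat (wt U) ∈ weightCone 𝒜 := fun U =>
    (semistableSet_nonempty_iff 𝒜).1 (hwt U ▸ U.2.1)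
  let φ : {U : Set (MaximalSpectrum R) // U.Nonempty ∧
      ∃ L : TrivialLinearization 𝒜, L.semistable = U} ↪o (gitCones 𝒜)ᵒᵈ :=
    OrderEmbedding.ofMapLEIff
      (fun U => OrderDual.toDual ⟨gitCone 𝒜 (wt U), wt U, hΩ U, rfl⟩) fun U U' => by
        change gitCone 𝒜 (wt U') ≤ gitCone 𝒜 (wt U) ↔ U.1 ⊆ U'.1
        rw [← semistableSet_subset_iff, ← hwt, ← hwt]
  have hφ : ∀ U, ∀ w : M, U.1 = semistableSet 𝒜 w →
      (OrderDual.ofDual (φ U)).1 = gitCone 𝒜 w := fun U w h =>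
    (semistableSet_eq_iff 𝒜).1 ((hwt U).symm.trans h)
  have hsurj : Function.Surjective φ := by
    intro σ
    obtain ⟨w, hw, hσ⟩ := (OrderDual.ofDual σ).2
    refine ⟨⟨semistableSet 𝒜 w, (semistableSet_nonempty_iff 𝒜).2 hw, _, rfl⟩, ?_⟩
    exact OrderDual.ofDual.injective (Subtype.ext ((hφ _ w rfl).trans hσ.symm))
  exact ⟨RelIso.ofSurjective φ hsurj, hφ⟩
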